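/- Let $k$ be a field and let $A=\bigoplus_{d\ge 0}A_d$ be a commutative standard graded $k$-algebra: $A_0=k$, $V:=A_1$ is finite-dimensional over $k$, and $A$ is generated by $A_1$ as a $k$-algebra. Assume that $A$ is Koszul, i.e. the residue field $k=A/A_+$ has a minimal graded free resolution $F_\bullet$ over $A$ in which each $F_i$ is generated in degree $i$. Let $Q_2=\ker(V\otimes_k V\to A_2)$ be the space of quadratic relations of $A$, and let $A^!=T(V^*)/(Q_2^{\perp})$ be the quadratic dual, where $Q_2^\perp\subseteq V^*\otimes_k V^*$ is the orthogonal complement of $Q_2$ with respect to the pairing $\langle v_1\otimes v_2,u_1\otimes u_2\rangle=u_1(v_1)u_2(v_2)$. Let $\ell_1,\dots,\ell_r\in A_1$ be linear forms that minimally generate the ideal $(\ell_1,\dots,\ell_r)$. Let $x_1,\dots,x_n$ be a $k$-basis of $A_1$ which contains $\ell_1,\dots,\ell_r$, let $x_1^*,\dots,x_n^*$ be the dual basis of $V^*$, and let $E\subseteq\{1,\dots,n\}$ be the set of the indices $i$ with $x_i\in\{\ell_1,\dots,\ell_r\}$. Consider the left ideal and the graded left $A^!$-module $$L:=\sum_{i\notin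 E}A^!x_i^*\subseteq A^!,\qquad B:=A^!/L .$$ The graded dual $B^*=\bigoplus_d B_d^*$, with $B_d^*=\operatorname{Hom}_k(B_d,k)$ placed in degree $d$, is a right $A^!$-module via $(\phi\cdot a)(b)=\phi(ab)$. Let $A\otimes_k B^*_\bullet$ be the complex of graded $A$-modules $$\cdots\to A\otimes_k B_d^*\to A\otimes_k B_{d-1}^*\to\cdots\to A\otimes_k B_1^*\to A\otimes_k B_0^*\cong A\to 0$$ with differential $a\otimes\phi\mapsto\sum_{i=1}^n a x_i\otimes \phi\cdot x_i^*$, where $A_a\otimes_k B_d^*$ has homological degree $d$ and internal degree $a+d$. Then $$\bigl(H_i(A\otimes_k B^*_\bullet)\bigr)_{i+j}=0\qquad\text{for all } i>0 \text{ and } j\in\{0,1\}.$$ -/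

import Mathlib

open scoped TensorProduct
open CategoryTheory

universe u v

section KoszulAlgebras

variable {k : Type u} [Field k] {A : Type v} [CommRing A] [Algebra k A]

/-- A commutative standard graded `k`-algebra: `A₀ = k`, and `A` is generated as a `k`-algebra by
the finite-dimensional space `A₁`. -/
structure IsStandardGraded (𝒜 : ℕ → Submodule k A) [GradedAlgebra 𝒜] : Prop where
  algebraMap_injective : Function.Injective (algebraMap k A)
  degree_zero : ∀ a ∈ 𝒜 0, ∃ c : k, algebraMap k A c = a
  generated : Algebra.adjoin k (𝒜 1 : Set A) = ⊤
  finite : Module.Finite k (𝒜 1)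

/-- The residue field `k = A / A₊`, as an `A`-module. -/
abbrev ResidueField (𝒜 : ℕ → Submodule k A) [GradedAlgebra 𝒜] : Type v :=
  A ⧸ (HomogeneousIdeal.irrelevant 𝒜).toIdeal

/-- A minimal graded free resolution
`⋯ → F₂ → F₁ → F₀ → k → 0` of the residue field over `A`, with `Fᵢ = ⨁ₚ A(-deg i p)` a free module
on finitely many homogeneous basis elements `eₚ` of degrees `deg i p`. -/
structure ResidueFieldResolution (𝒜 : ℕ → Submodule k A) [GradedAlgebra 𝒜] where
  rank : ℕ → ℕ
  deg : (i : ℕ) → Fin (rank i) → ℕ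
  d : (i : ℕ) → (Fin (rank (i + 1)) → A) →ₗ[A] (Fin (rank i) → A)
  aug : (Fin (rank 0) → A) →ₗ[A] ResidueField 𝒜
  /-- The differentials are homogeneous of degree zero. -/
  d_homogeneous : ∀ i q p, deg i p ≤ deg (i + 1) q →
    d i (Pi.single q 1) p ∈ 𝒜 (deg (i + 1) q - deg i p)
  d_eq_zero : ∀ i q p, deg (i + 1) q < deg i p → d i (Pi.single q 1) p = 0
  /-- The augmentation is homogeneous of degree zero (the residue field sits in degree zero). -/
  aug_homogeneous : ∀ p, deg 0 p ≠ 0 → aug (Pi.single p 1) = 0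
  aug_degree_zero : ∀ p, deg 0 p = 0 →
    ∃ a ∈ 𝒜 0, aug (Pi.single p 1) = Ideal.Quotient.mk _ a
  /-- Minimality: `d(Fᵢ₊₁) ⊆ A₊ Fᵢ`. -/
  minimal : ∀ i q p, d i (Pi.single q 1) p ∈ (HomogeneousIdeal.irrelevant 𝒜).toIdeal
  exact : ∀ i, Function.Exact (d (i + 1)) (d i)
  exact_aug : Function.Exact (d 0) aug
  aug_surjective : Function.Surjective aug

/-- The resolution is linear: `Fᵢ` is generated in degree `i`. -/
def ResidueFieldResolution.IsLinear {𝒜 : ℕ → Submodule k A} [GradedAlgebra 𝒜]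
    (F : ResidueFieldResolution 𝒜) : Prop :=
  ∀ i p, F.deg i p = i

/-- A (commutative, standard graded) Koszul algebra: the residue field has a linear minimal
graded free resolution. -/
structure IsKoszul (𝒜 : ℕ → Submodule k A) [GradedAlgebra 𝒜] : Prop where
  standard : IsStandardGraded 𝒜
  linear : ∃ F : ResidueFieldResolution 𝒜, F.IsLinear

/-- The elements `ℓ₁, …, ℓᵣ` minimally generate the ideal `(ℓ₁, …, ℓᵣ)`: none can be omitted. -/
def MinimallyGenerates {r : ℕ} (ℓ : Fin r → A) : Prop :=
  ∀ j, ℓ j ∉ Ideal.span (ℓ '' {i | i ≠ j})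

/-! ### The quadratic dual -/

/-- The multiplication `V ⊗ V → A`, where `V = A₁`. -/
noncomputable def mulDegreeOne (𝒜 : ℕ → Submodule k A) : 𝒜 1 ⊗[k] 𝒜 1 →ₗ[k] A :=
  LinearMap.mul' k A ∘ₗ TensorProduct.map (𝒜 1).subtype (𝒜 1).subtype

/-- The space `Q₂ ⊆ V ⊗ V` of quadratic relations of `A`. -/
noncomputable def quadraticRelations (𝒜 : ℕ → Submodule k A) : Submodule k (𝒜 1 ⊗[k] 𝒜 1) :=
  LinearMap.ker (mulDegreeOne 𝒜)

/-- The orthogonal complement of `Q₂` in `V* ⊗ V*`, for the pairing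
`⟨v₁ ⊗ v₂, u₁ ⊗ u₂⟩ = u₁(v₁) u₂(v₂)`. -/
noncomputable def dualRelations (𝒜 : ℕ → Submodule k A) :
    Submodule k (Module.Dual k (𝒜 1) ⊗[k] Module.Dual k (𝒜 1)) where
  carrier := {w | ∀ q ∈ quadraticRelations 𝒜, TensorProduct.dualDistrib k (𝒜 1) (𝒜 1) w q = 0}
  add_mem' := fun ha hb q hq => by simp [ha q hq, hb q hq]
  zero_mem' := fun q _ => by simp
  smul_mem' := fun c _ ha q hq => by simp [ha q hq]

/-- The inclusion `V* ⊗ V* → T(V*)` in tensor degree two. -/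
noncomputable def tensorDegreeTwo (𝒜 : ℕ → Submodule k A) :
    Module.Dual k (𝒜 1) ⊗[k] Module.Dual k (𝒜 1) →ₗ[k] TensorAlgebra k (Module.Dual k (𝒜 1)) :=
  LinearMap.mul' k _ ∘ₗ TensorProduct.map (TensorAlgebra.ι k) (TensorAlgebra.ι k)

/-- The relations `w = 0` for `w ∈ Q₂^⊥`. -/
inductive QuadraticDual.Rel (𝒜 : ℕ → Submodule k A) :
    TensorAlgebra k (Module.Dual k (𝒜 1)) → TensorAlgebra k (Module.Dual k (𝒜 1)) → Prop
  | of (w : Module.Dual k (𝒜 1) ⊗[k] Module.Dual k (𝒜 1)) (hw : w ∈ dualRelations 𝒜) :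
      QuadraticDual.Rel 𝒜 (tensorDegreeTwo 𝒜 w) 0

/-- The quadratic dual `A^! = T(V*) / (Q₂^⊥)`. -/
abbrev QuadraticDual (𝒜 : ℕ → Submodule k A) : Type (max u v) :=
  RingQuot (QuadraticDual.Rel 𝒜)

/-- The canonical map `V* → A^!`, with image `(A^!)₁`. -/
noncomputable def QuadraticDual.ι (𝒜 : ℕ → Submodule k A) :
    Module.Dual k (𝒜 1) →ₗ[k] QuadraticDual 𝒜 :=
  (RingQuot.mkAlgHom k (QuadraticDual.Rel 𝒜)).toLinearMap ∘ₗ TensorAlgebra.ι k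

/-- The graded component `(A^!)_d`, spanned by the products of `d` elements of `V*`. -/
noncomputable def QuadraticDual.component (𝒜 : ℕ → Submodule k A) (d : ℕ) :
    Submodule k (QuadraticDual 𝒜) :=
  LinearMap.range (QuadraticDual.ι 𝒜) ^ d

/-! ### The subcomplex of the Priddy complex -/

variable (𝒜 : ℕ → Submodule k A)

/-- The left ideal `L = ∑_{i ∉ E} A^! xᵢ*` of `A^!`, where `x` is a basis of `A₁`. -/
noncomputable def leftIdealOf {n : ℕ} (x : Module.Basis (Fin n) k (𝒜 1)) (E : Set (Fin n)) :
    Submodule (QuadraticDual 𝒜) (QuadraticDual 𝒜) :=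
  Submodule.span (QuadraticDual 𝒜) ((fun i => QuadraticDual.ι 𝒜 (x.coord i)) '' Eᶜ)

/-- The graded component `B_d` of the left `A^!`-module `B = A^! / L`. -/
noncomputable def quotComponent (L : Submodule (QuadraticDual 𝒜) (QuadraticDual 𝒜)) (d : ℕ) :
    Submodule k (QuadraticDual 𝒜 ⧸ L) :=
  (QuadraticDual.component 𝒜 d).map (L.mkQ.restrictScalars k)

lemma ι_smul_mem_quotComponent (L : Submodule (QuadraticDual 𝒜) (QuadraticDual 𝒜)) (d : ℕ)
    (f : Module.Dual k (𝒜 1)) {b : QuadraticDual 𝒜 ⧸ L} (hb : b ∈ quotComponent 𝒜 L d) :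
    QuadraticDual.ι 𝒜 f • b ∈ quotComponent 𝒜 L (d + 1) := by
  obtain ⟨a, ha, rfl⟩ := hb
  refine ⟨QuadraticDual.ι 𝒜 f * a, ?_, ?_⟩
  · unfold QuadraticDual.component
    rw [pow_succ']
    exact Submodule.mul_mem_mul ⟨f, rfl⟩ ha
  · simp [← smul_eq_mul]

/-- Left multiplication `B_d → B_{d+1}` by an element `f ∈ V* = (A^!)₁`. -/
noncomputable def leftMul (L : Submodule (QuadraticDual 𝒜) (QuadraticDual 𝒜)) (d : ℕ)
    (f : Module.Dual k (𝒜 1)) : quotComponent 𝒜 L d →ₗ[k] quotComponent 𝒜 L (d + 1) where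
  toFun b := ⟨QuadraticDual.ι 𝒜 f • (b : QuadraticDual 𝒜 ⧸ L),
    ι_smul_mem_quotComponent 𝒜 L d f b.2⟩
  map_add' a b := by ext; simp
  map_smul' c b := by
    ext
    simp only [Submodule.coe_smul, RingHom.id_apply]
    exact smul_comm _ _ _

/-- The right action `φ ↦ φ · f` of `f ∈ (A^!)₁` on the graded dual `B*`, given by
`(φ · f)(b) = φ(f b)`, as a map `B*_{d+1} → B*_d`. -/
noncomputable def dualAct (L : Submodule (QuadraticDual 𝒜) (QuadraticDual 𝒜)) (d : ℕ)
    (f : Module.Dual k (𝒜 1)) :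
    Module.Dual k (quotComponent 𝒜 L (d + 1)) →ₗ[k] Module.Dual k (quotComponent 𝒜 L d) :=
  (leftMul 𝒜 L d f).dualMap

/-- The differential `A ⊗ B*_{d+1} → A ⊗ B*_d`, right multiplication by the trace element
`∑ᵢ xᵢ ⊗ xᵢ*`: it sends `a ⊗ φ` to `∑ᵢ a xᵢ ⊗ φ · xᵢ*`. -/
noncomputable def traceDifferential {n : ℕ} (x : Module.Basis (Fin n) k (𝒜 1))
    (L : Submodule (QuadraticDual 𝒜) (QuadraticDual 𝒜)) (d : ℕ) :
    A ⊗[k] Module.Dual k (quotComponent 𝒜 L (d + 1)) →ₗ[A]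
      A ⊗[k] Module.Dual k (quotComponent 𝒜 L d) :=
  ∑ i, TensorProduct.AlgebraTensorModule.map (LinearMap.toSpanSingleton A A (x i : A))
    (dualAct 𝒜 L d (x.coord i))

lemma traceDifferential_tmul {n : ℕ} (x : Module.Basis (Fin n) k (𝒜 1))
    (L : Submodule (QuadraticDual 𝒜) (QuadraticDual 𝒜)) (d : ℕ) (a : A)
    (φ : Module.Dual k (quotComponent 𝒜 L (d + 1))) :
    traceDifferential 𝒜 x L d (a ⊗ₜ φ) =
      ∑ i, (a * (x i : A)) ⊗ₜ[k] dualAct 𝒜 L d (x.coord i) φ := by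
  simp [traceDifferential, LinearMap.sum_apply]

lemma dualAct_dualAct_apply (L : Submodule (QuadraticDual 𝒜) (QuadraticDual 𝒜)) (d : ℕ)
    (f g : Module.Dual k (𝒜 1)) (φ : Module.Dual k (quotComponent 𝒜 L (d + 1 + 1)))
    (b : quotComponent 𝒜 L d) :
    dualAct 𝒜 L d g (dualAct 𝒜 L (d + 1) f φ) b =
      φ ⟨QuadraticDual.ι 𝒜 f • QuadraticDual.ι 𝒜 g • (b : QuadraticDual 𝒜 ⧸ L),
        ι_smul_mem_quotComponent 𝒜 L _ f (ι_smul_mem_quotComponent 𝒜 L _ g b.2)⟩ := rfl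

/-- If `∑ c p q • x_p* ⊗ x_q*` is orthogonal to `Q₂`, then `∑ c p q • x_p* x_q* = 0` in `A^!`. -/
lemma sum_ι_mul_ι_eq_zero {n : ℕ} (x : Module.Basis (Fin n) k (𝒜 1))
    (ξ : Module.Dual k (𝒜 1 ⊗[k] 𝒜 1)) (hξ : ∀ q ∈ quadraticRelations 𝒜, ξ q = 0) :
    ∑ p, ∑ q, ξ (x p ⊗ₜ x q) •
      (QuadraticDual.ι 𝒜 (x.coord p) * QuadraticDual.ι 𝒜 (x.coord q)) = 0 := by
  set θ : Module.Dual k (𝒜 1) ⊗[k] Module.Dual k (𝒜 1) :=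
    ∑ p, ∑ q, ξ (x p ⊗ₜ x q) • (x.coord p ⊗ₜ[k] x.coord q) with hθ
  have key : TensorProduct.dualDistrib k (𝒜 1) (𝒜 1) θ = ξ := by
    refine (x.tensorProduct x).ext ?_
    rintro ⟨p, q⟩
    simp [hθ, LinearMap.sum_apply, Finsupp.single_apply, Finset.sum_ite_eq]
  have hmem : θ ∈ dualRelations 𝒜 := fun q hq => by rw [key]; exact hξ q hq
  have h0 := RingQuot.mkAlgHom_rel k (QuadraticDual.Rel.of θ hmem)
  rw [map_zero] at h0
  rw [← h0, hθ]
  simp [tensorDegreeTwo, QuadraticDual.ι, map_sum]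

lemma traceDifferential_comp {n : ℕ} (x : Module.Basis (Fin n) k (𝒜 1))
    (L : Submodule (QuadraticDual 𝒜) (QuadraticDual 𝒜)) (d : ℕ) :
    traceDifferential 𝒜 x L d ∘ₗ traceDifferential 𝒜 x L (d + 1) = 0 := by
  refine TensorProduct.AlgebraTensorModule.ext fun a φ => ?_
  have : Module.Finite k (𝒜 1) := Module.Finite.of_basis x
  let c := Module.finBasis k (LinearMap.range (mulDegreeOne 𝒜))
  let μ : LinearMap.range (mulDegreeOne 𝒜) →ₗ[k] A := (LinearMap.range (mulDegreeOne 𝒜)).subtype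
  let ξ : Fin (Module.finrank k (LinearMap.range (mulDegreeOne 𝒜))) →
      Module.Dual k (𝒜 1 ⊗[k] 𝒜 1) := fun j => c.coord j ∘ₗ (mulDegreeOne 𝒜).rangeRestrict
  have hξ : ∀ j, ∀ q ∈ quadraticRelations 𝒜, ξ j q = 0 := fun j q hq => by
    have h1 : (mulDegreeOne 𝒜).rangeRestrict q = 0 := Subtype.ext hq
    simp [ξ, h1]
  have hμ : ∀ p q, (x p : A) * (x q : A) = ∑ j, ξ j (x p ⊗ₜ x q) • μ (c j) := fun p q => by
    have h1 : (x p : A) * (x q : A) = μ ((mulDegreeOne 𝒜).rangeRestrict (x p ⊗ₜ x q)) := by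
      change _ = mulDegreeOne 𝒜 (x p ⊗ₜ x q)
      simp [mulDegreeOne]
    rw [h1]
    conv_lhs => rw [← c.sum_repr ((mulDegreeOne 𝒜).rangeRestrict (x p ⊗ₜ x q))]
    rw [map_sum]
    simp only [map_smul]
    rfl
  have hφ : ∀ j, ∑ p, ∑ q, ξ j (x p ⊗ₜ x q) •
      dualAct 𝒜 L d (x.coord q) (dualAct 𝒜 L (d + 1) (x.coord p) φ) = 0 := fun j => by
    ext b
    simp only [LinearMap.sum_apply, LinearMap.smul_apply, dualAct_dualAct_apply,
      LinearMap.zero_apply, ← map_smul, ← map_sum]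
    convert map_zero φ
    ext
    have h := congrArg (· • (b : QuadraticDual 𝒜 ⧸ L)) (sum_ι_mul_ι_eq_zero 𝒜 x (ξ j) (hξ j))
    simpa [Finset.sum_smul, mul_smul, smul_assoc] using h
  have hcalc : ∑ p, ∑ q, (a * (x p : A) * (x q : A)) ⊗ₜ[k]
      dualAct 𝒜 L d (x.coord q) (dualAct 𝒜 L (d + 1) (x.coord p) φ) =
      ∑ j, (a * μ (c j)) ⊗ₜ[k] ∑ p, ∑ q, ξ j (x p ⊗ₜ x q) •
        dualAct 𝒜 L d (x.coord q) (dualAct 𝒜 L (d + 1) (x.coord p) φ) := by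
    simp only [mul_assoc, hμ, Finset.mul_sum, TensorProduct.sum_tmul, TensorProduct.tmul_sum]
    rw [Finset.sum_comm_cycle]
    simp only [mul_smul_comm, TensorProduct.smul_tmul]
  simp only [LinearMap.comp_apply, traceDifferential_tmul, map_sum, LinearMap.zero_apply]
  rw [hcalc]
  simp [hφ]

/-- The complex `⋯ → A ⊗ B*_d → A ⊗ B*_{d-1} → ⋯ → A ⊗ B*_1 → A ⊗ B*_0 ≅ A → 0` of
`A`-modules, for `B = A^! / L`. -/
noncomputable def subPriddyComplex {n : ℕ} (x : Module.Basis (Fin n) k (𝒜 1))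
    (L : Submodule (QuadraticDual 𝒜) (QuadraticDual 𝒜)) :
    ChainComplex (ModuleCat.{max u v} A) ℕ :=
  ChainComplex.of (fun d => ModuleCat.of A (A ⊗[k] Module.Dual k (quotComponent 𝒜 L d)))
    (fun d => ModuleCat.ofHom (traceDifferential 𝒜 x L d))
    (fun d => by
      rw [← ModuleCat.ofHom_comp, traceDifferential_comp]
      rfl)

/-- The component `A_{m-i} ⊗ B*_i` of internal degree `m` of `A ⊗ B*_i` (it is zero for
`m < i`). -/
noncomputable def internalComponent (L : Submodule (QuadraticDual 𝒜) (QuadraticDual 𝒜))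
    (i m : ℕ) : Submodule k (A ⊗[k] Module.Dual k (quotComponent 𝒜 L i)) :=
  ⨆ (a : ℕ) (_ : a + i = m),
    LinearMap.range ((𝒜 a).subtype.rTensor (Module.Dual k (quotComponent 𝒜 L i)))

/-- The component of internal degree `m` of the homology `H_i(A ⊗ B*)`: the classes of the cycles
of internal degree `m`. -/
noncomputable def homologyComponent {n : ℕ} (x : Module.Basis (Fin n) k (𝒜 1))
    (L : Submodule (QuadraticDual 𝒜) (QuadraticDual 𝒜)) (i m : ℕ) :
    AddSubgroup ((subPriddyComplex 𝒜 x L).homology i) :=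
  AddSubgroup.map ((subPriddyComplex 𝒜 x L).homologyπ i).hom.toAddMonoidHom
    (AddSubgroup.comap ((subPriddyComplex 𝒜 x L).iCycles i).hom.toAddMonoidHom
      (internalComponent 𝒜 L i m).toAddSubgroup)

/-- Linear forms that minimally generate an ideal are part of a basis of `A₁`, so the variables
can be chosen in such a way that these linear forms are among them. -/
lemma MinimallyGenerates.exists_basis [Module.Finite k (𝒜 1)] {r : ℕ} {ℓ : Fin r → 𝒜 1}
    (hℓ : MinimallyGenerates (fun j => (ℓ j : A))) :
    ∃ (n : ℕ) (x : Module.Basis (Fin n) k (𝒜 1)) (e : Fin r → Fin n), ∀ j, x (e j) = ℓ j := by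
  have hli : LinearIndependent k ℓ := by
    rw [linearIndependent_iff_notMem_span]
    intro j hj
    refine hℓ j ?_
    have h2 : (ℓ j : A) ∈ (Submodule.span k (ℓ '' (Set.univ \ {j}))).map (𝒜 1).subtype :=
      ⟨ℓ j, hj, rfl⟩
    rw [Submodule.map_span] at h2
    have h3 : Submodule.span k ((𝒜 1).subtype '' (ℓ '' (Set.univ \ {j}))) ≤
        (Ideal.span ((fun j => (ℓ j : A)) '' {i | i ≠ j})).restrictScalars k := by
      rw [Submodule.span_le]
      rintro _ ⟨_, ⟨i, hi, rfl⟩, rfl⟩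
      exact Ideal.subset_span ⟨i, by simpa using hi, rfl⟩
    exact h3 h2
  let b := Module.Basis.extend hli.linearIndepOn_id
  let : Fintype (hli.linearIndepOn_id.extend (Set.subset_univ _)) :=
    FiniteDimensional.fintypeBasisIndex b
  let e' := Fintype.equivFin (hli.linearIndepOn_id.extend (Set.subset_univ _))
  refine ⟨_, b.reindex e', fun j => e' ⟨ℓ j, hli.linearIndepOn_id.subset_extend _ ⟨j, rfl⟩⟩,
    fun j => ?_⟩
  simp [b]

end KoszulAlgebras

/-! Write $i=d+1$. The claim says that a cycle of internal degree $i+j$ with $j\le 1$ is a boundary.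

For $j=0$ a cycle is $1\otimes\varphi$ with $\varphi\in B_{d+1}^*$. Since the $x_q$ are independent,
$\sum_q x_q\otimes\varphi\cdot x_q^*=0$ forces $\varphi$ to vanish on $V^*B_d=B_{d+1}$, so
$\varphi=0$ (`eq_zero_of_mem_internalComponent`).

For $j=1$ a cycle is $\sum_p x_p\otimes\varphi_p$ with $\varphi_p\in B_{d+1}^*$. A functional on
$V\otimes V$ factors through the multiplication into $A$ exactly when it kills $Q_2$, so the cycle
condition says that the $\varphi_p$ respect every relation in $Q_2^\perp$
(`sum_dualDistrib_mul_eq_zero`). Let $\Phi_f$ be the functional on $B$, linear in $f\in V^*$, with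
$\Phi_{x_p^*}$ equal to $\varphi_p$ extended by zero to the other degrees. Then
$f\cdot(b,c)=(fb,\Phi_f(b))$ makes $B\times k$ an $A^!$-module, an extension of $B$ by $k$. The
vector $(1,0)$ is killed by the generators of $L$ because $\Phi_f(1)=0$, so $1\mapsto(1,0)$ defines
a splitting $B\to B\times k$. Its second coordinate $\Psi$ satisfies $\Psi(fb)=\Phi_f(b)$
(`exists_functional`), and $1\otimes\Psi|_{B_{d+2}}$ bounds the cycle. In short, $L$ is generated in
degree one, so the cyclic module $B$ has no other obstruction to this splitting. -/

section LinearStrand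

variable {k : Type u} [Field k] {A : Type v} [CommRing A] [Algebra k A]
  {𝒜 : ℕ → Submodule k A}

/-! ### Universal properties of $A^!$ and of $A^!/L$. -/

/-- A `k`-linear action of `V*` that satisfies the quadratic relations extends to `A^!`. -/
noncomputable def QuadraticDual.lift {R : Type*} [Ring R] [Algebra k R]
    (act : Module.Dual k (𝒜 1) →ₗ[k] R)
    (h : ∀ w ∈ dualRelations 𝒜, LinearMap.mul' k R (TensorProduct.map act act w) = 0) :
    QuadraticDual 𝒜 →ₐ[k] R :=
  RingQuot.liftAlgHom k ⟨TensorAlgebra.lift k act, by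
    rintro _ _ ⟨w, hw⟩
    rw [map_zero, ← h w hw]
    have : (TensorAlgebra.lift k act).toLinearMap ∘ₗ tensorDegreeTwo 𝒜 =
        LinearMap.mul' k R ∘ₗ TensorProduct.map act act := by
      ext f g
      simp [tensorDegreeTwo]
    exact LinearMap.congr_fun this w⟩

@[simp]
lemma QuadraticDual.lift_ι {R : Type*} [Ring R] [Algebra k R]
    (act : Module.Dual k (𝒜 1) →ₗ[k] R)
    (h : ∀ w ∈ dualRelations 𝒜, LinearMap.mul' k R (TensorProduct.map act act w) = 0)
    (f : Module.Dual k (𝒜 1)) :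
    QuadraticDual.lift act h (QuadraticDual.ι 𝒜 f) = act f := by
  simp [QuadraticDual.lift, QuadraticDual.ι]

/-- The quadratic relations in coordinates. -/
lemma sum_dualDistrib_smul {n : ℕ} {V : Type*} [AddCommGroup V] [Module k V]
    (x : Module.Basis (Fin n) k V) {R : Type*} [Ring R] [Algebra k R] (act : Module.Dual k V →ₗ[k] R)
    (w : Module.Dual k V ⊗[k] Module.Dual k V) :
    LinearMap.mul' k R (TensorProduct.map act act w) =
      ∑ p, ∑ q, TensorProduct.dualDistrib k V V w (x p ⊗ₜ x q) •
        (act (x.coord p) * act (x.coord q)) := by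
  induction w with
  | zero => simp
  | add a b ha hb => simp [ha, hb, add_smul, Finset.sum_add_distrib]
  | tmul f g =>
    have expand (f : Module.Dual k V) : act f = ∑ p, f (x p) • act (x.coord p) := by
      conv_lhs => rw [← x.sum_dual_apply_smul_coord f]
      simp only [map_sum, map_smul]
    rw [TensorProduct.map_tmul, LinearMap.mul'_apply, expand f, expand g, Finset.sum_mul_sum]
    simp only [smul_mul_smul_comm, TensorProduct.dualDistrib_apply]

lemma sum_dualRelations_smul_eq_zero {n : ℕ} (x : Module.Basis (Fin n) k (𝒜 1))
    {w : Module.Dual k (𝒜 1) ⊗[k] Module.Dual k (𝒜 1)} (hw : w ∈ dualRelations 𝒜)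
    {M : Type*} [AddCommGroup M] [Module k M] [Module (QuadraticDual 𝒜) M]
    [IsScalarTower k (QuadraticDual 𝒜) M] (b : M) :
    ∑ p, ∑ q, TensorProduct.dualDistrib k (𝒜 1) (𝒜 1) w (x p ⊗ₜ x q) •
      QuadraticDual.ι 𝒜 (x.coord p) • QuadraticDual.ι 𝒜 (x.coord q) • b = 0 := by
  have h := congrArg (· • b) (sum_ι_mul_ι_eq_zero 𝒜 x _ hw)
  simpa [Finset.sum_smul, mul_smul, smul_assoc] using h

/-- Universal property of the cyclic module `A^! / L`: a vector `m` of a `V*`-representation that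
satisfies the quadratic relations, killed by the generators of `L`, is the image of `1`. -/
lemma exists_linearMap_of_relations {n : ℕ} (x : Module.Basis (Fin n) k (𝒜 1)) (E : Set (Fin n))
    {M : Type*} [AddCommGroup M] [Module k M]
    (act : Module.Dual k (𝒜 1) →ₗ[k] Module.End k M)
    (h : ∀ w ∈ dualRelations 𝒜, ∀ u, ∑ p, ∑ q,
      TensorProduct.dualDistrib k (𝒜 1) (𝒜 1) w (x p ⊗ₜ x q) •
        act (x.coord p) (act (x.coord q) u) = 0)
    (m : M) (hm : ∀ s ∉ E, act (x.coord s) m = 0) :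
    ∃ Θ : (QuadraticDual 𝒜 ⧸ leftIdealOf 𝒜 x E) →ₗ[k] M,
      Θ (Submodule.Quotient.mk 1) = m ∧
      ∀ f b, Θ (QuadraticDual.ι 𝒜 f • b) = act f (Θ b) := by
  let ρ := QuadraticDual.lift act fun w hw => by
    rw [sum_dualDistrib_smul x]
    refine LinearMap.ext fun u => ?_
    simpa [LinearMap.sum_apply] using h w hw u
  let Θ₀ : QuadraticDual 𝒜 →ₗ[k] M := (LinearMap.applyₗ m) ∘ₗ ρ.toLinearMap
  have hΘ₀ : ∀ a, Θ₀ a = ρ a m := fun a => rfl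
  have hL : (leftIdealOf 𝒜 x E).restrictScalars k ≤ LinearMap.ker Θ₀ := by
    intro a ha
    rw [Submodule.restrictScalars_mem] at ha
    rw [LinearMap.mem_ker, hΘ₀]
    refine Submodule.span_induction ?_ ?_ ?_ ?_ ha
    · rintro _ ⟨s, hs, rfl⟩
      simpa [ρ] using hm s hs
    · simp
    · intro a b _ _ ha hb
      simp [ha, hb]
    · intro c a _ ha
      simp [ha]
  let Θ : (QuadraticDual 𝒜 ⧸ leftIdealOf 𝒜 x E) →ₗ[k] M :=
    ((leftIdealOf 𝒜 x E).restrictScalars k).liftQ Θ₀ hL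
  have hΘ : ∀ a, Θ (Submodule.Quotient.mk a) = ρ a m := fun a => rfl
  refine ⟨Θ, by simp [hΘ], fun f b => ?_⟩
  obtain ⟨a, rfl⟩ := Submodule.Quotient.mk_surjective _ b
  rw [← Submodule.Quotient.mk_smul, hΘ, hΘ]
  simp [ρ]

lemma mk_one_mem_quotComponent (L : Submodule (QuadraticDual 𝒜) (QuadraticDual 𝒜)) :
    (Submodule.Quotient.mk 1 : QuadraticDual 𝒜 ⧸ L) ∈ quotComponent 𝒜 L 0 :=
  ⟨1, by simp [QuadraticDual.component, Submodule.one_le.mp], rfl⟩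

lemma quotComponent_induction {L : Submodule (QuadraticDual 𝒜) (QuadraticDual 𝒜)} {d : ℕ}
    {P : (QuadraticDual 𝒜 ⧸ L) → Prop}
    (hι : ∀ f, ∀ b ∈ quotComponent 𝒜 L d, P (QuadraticDual.ι 𝒜 f • b))
    (hadd : ∀ b c, P b → P c → P (b + c))
    {b : QuadraticDual 𝒜 ⧸ L} (hb : b ∈ quotComponent 𝒜 L (d + 1)) : P b := by
  obtain ⟨a, ha, rfl⟩ := hb
  unfold QuadraticDual.component at ha
  rw [SetLike.mem_coe, pow_succ'] at ha
  refine Submodule.mul_induction_on ha ?_ ?_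
  · rintro _ ⟨f, rfl⟩ c hc
    exact hι f _ ⟨c, hc, rfl⟩
  · intro a c ha hc
    rw [map_add]
    exact hadd _ _ ha hc

/-! ### The grading of $B$. -/

/-- `V*` acts on `∏ B_d` by the shifted left multiplications. -/
noncomputable def shiftAct (L : Submodule (QuadraticDual 𝒜) (QuadraticDual 𝒜)) :
    Module.Dual k (𝒜 1) →ₗ[k] Module.End k (∀ d, quotComponent 𝒜 L d) where
  toFun f :=
    { toFun := fun u d => match d with
        | 0 => 0
        | d + 1 => leftMul 𝒜 L d f (u d)
      map_add' := fun u v => by ext (_ | d) <;> simp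
      map_smul' := fun c u => by ext (_ | d) <;> simp }
  map_add' f g := by
    ext u (_ | d) <;> simp [leftMul, add_smul]
  map_smul' c f := by
    ext u (_ | d) <;> simp [leftMul, smul_assoc]

lemma shiftAct_zero (L : Submodule (QuadraticDual 𝒜) (QuadraticDual 𝒜))
    (f : Module.Dual k (𝒜 1)) (u : ∀ d, quotComponent 𝒜 L d) : shiftAct L f u 0 = 0 := rfl

lemma shiftAct_succ (L : Submodule (QuadraticDual 𝒜) (QuadraticDual 𝒜))
    (f : Module.Dual k (𝒜 1)) (u : ∀ d, quotComponent 𝒜 L d) (d : ℕ) :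
    shiftAct L f u (d + 1) = leftMul 𝒜 L d f (u d) := rfl

lemma shiftAct_relations {n : ℕ} (x : Module.Basis (Fin n) k (𝒜 1))
    (L : Submodule (QuadraticDual 𝒜) (QuadraticDual 𝒜))
    (w : Module.Dual k (𝒜 1) ⊗[k] Module.Dual k (𝒜 1)) (hw : w ∈ dualRelations 𝒜)
    (u : ∀ d, quotComponent 𝒜 L d) :
    ∑ p, ∑ q, TensorProduct.dualDistrib k (𝒜 1) (𝒜 1) w (x p ⊗ₜ x q) •
      shiftAct L (x.coord p) (shiftAct L (x.coord q) u) = 0 := by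
  refine funext fun d => Subtype.ext ?_
  simp only [Finset.sum_apply, Pi.smul_apply, Pi.zero_apply]
  -- Two shifts leave nothing in degrees 0 and 1; from degree 2 on this is the relation in $B$.
  rcases d with _ | _ | d
  · simp [shiftAct_zero]
  · simp [shiftAct_zero, shiftAct_succ]
  · simpa [shiftAct_succ, leftMul] using
      sum_dualRelations_smul_eq_zero x hw (u d : QuadraticDual 𝒜 ⧸ L)

/-- The projections of `B = A^! / L` onto its graded components. -/
lemma exists_quotComponent_proj {n : ℕ} (x : Module.Basis (Fin n) k (𝒜 1)) (E : Set (Fin n)) :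
    ∃ π : (QuadraticDual 𝒜 ⧸ leftIdealOf 𝒜 x E) →ₗ[k]
        (∀ d, quotComponent 𝒜 (leftIdealOf 𝒜 x E) d),
      (∀ f b d, π (QuadraticDual.ι 𝒜 f • b) (d + 1) = leftMul 𝒜 _ d f (π b d)) ∧
      (∀ d, π (Submodule.Quotient.mk 1) (d + 1) = 0) ∧
      ∀ d, ∀ b : quotComponent 𝒜 (leftIdealOf 𝒜 x E) d, π b d = b := by
  obtain ⟨π, h1, hπ⟩ := exists_linearMap_of_relations x E (shiftAct (leftIdealOf 𝒜 x E))
    (shiftAct_relations x _) (Pi.single 0 ⟨_, mk_one_mem_quotComponent _⟩) (by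
      -- Only degree 1 is at stake: there $x_s^*\cdot 1=0$ in $B$, as $x_s^*\in L$ for $s\notin E$.
      intro s hs
      refine funext fun d => Subtype.ext ?_
      rcases d with _ | _ | d
      · simp [shiftAct_zero]
      · rw [shiftAct_succ, Pi.single_eq_same]
        change QuadraticDual.ι 𝒜 (x.coord s) • Submodule.Quotient.mk 1 = 0
        rw [← Submodule.Quotient.mk_smul, smul_eq_mul, mul_one, Submodule.Quotient.mk_eq_zero]
        exact Submodule.subset_span ⟨s, hs, rfl⟩
      · simp [shiftAct_succ])
  refine ⟨π, fun f b d => by rw [hπ, shiftAct_succ], fun d => by simp [h1], fun d => ?_⟩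
  suffices ∀ b ∈ quotComponent 𝒜 (leftIdealOf 𝒜 x E) d,
      (π b d : QuadraticDual 𝒜 ⧸ leftIdealOf 𝒜 x E) = b from
    fun b => Subtype.ext (this b b.2)
  induction d with
  | zero =>
    rintro _ ⟨a, ha, rfl⟩
    simp only [QuadraticDual.component, pow_zero, SetLike.mem_coe, Submodule.mem_one] at ha
    obtain ⟨c, rfl⟩ := ha
    rw [Algebra.algebraMap_eq_smul_one, map_smul, map_smul]
    change ((c • π (Submodule.Quotient.mk 1) 0 : quotComponent 𝒜 _ 0) :
      QuadraticDual 𝒜 ⧸ leftIdealOf 𝒜 x E) = c • Submodule.Quotient.mk 1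
    rw [h1]
    simp
  | succ d ih =>
    intro b hb
    refine quotComponent_induction
      (P := fun b => (π b (d + 1) : QuadraticDual 𝒜 ⧸ leftIdealOf 𝒜 x E) = b)
      (fun f b hb => ?_) (fun b c hb hc => ?_) hb
    · rw [hπ, shiftAct_succ]
      simp [leftMul, ih b hb]
    · rw [map_add, Pi.add_apply, Submodule.coe_add, hb, hc]

/-! ### Splitting the extension of $B$ by $k$. -/

/-- The action of `V*` on the extension `B × k` of `B = A^! / L` given by functionals `Φ` on `B`. -/
noncomputable def extensionAct (L : Submodule (QuadraticDual 𝒜) (QuadraticDual 𝒜))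
    (Φ : Module.Dual k (𝒜 1) →ₗ[k] Module.Dual k (QuadraticDual 𝒜 ⧸ L)) :
    Module.Dual k (𝒜 1) →ₗ[k] Module.End k ((QuadraticDual 𝒜 ⧸ L) × k) where
  toFun f :=
    { toFun := fun u => (QuadraticDual.ι 𝒜 f • u.1, Φ f u.1)
      map_add' := fun u v => by simp
      map_smul' := fun c u => by simp [smul_comm _ c] }
  map_add' f g := LinearMap.ext fun u => by simp [add_smul]
  map_smul' c f := LinearMap.ext fun u => by simp [smul_assoc]

lemma extensionAct_apply (L : Submodule (QuadraticDual 𝒜) (QuadraticDual 𝒜))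
    (Φ : Module.Dual k (𝒜 1) →ₗ[k] Module.Dual k (QuadraticDual 𝒜 ⧸ L))
    (f : Module.Dual k (𝒜 1)) (u : (QuadraticDual 𝒜 ⧸ L) × k) :
    extensionAct L Φ f u = (QuadraticDual.ι 𝒜 f • u.1, Φ f u.1) := rfl

/-- Functionals `Φ f` on `B` that are compatible with the quadratic relations, and vanish on `1`,
come from one functional `Ψ` with `Φ f b = Ψ (f b)`. -/
lemma exists_functional {n : ℕ} (x : Module.Basis (Fin n) k (𝒜 1)) (E : Set (Fin n))
    (Φ : Module.Dual k (𝒜 1) →ₗ[k] Module.Dual k (QuadraticDual 𝒜 ⧸ leftIdealOf 𝒜 x E))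
    (hΦ : ∀ b, ∀ w ∈ dualRelations 𝒜, ∑ p, ∑ q,
      TensorProduct.dualDistrib k (𝒜 1) (𝒜 1) w (x p ⊗ₜ x q) *
        Φ (x.coord p) (QuadraticDual.ι 𝒜 (x.coord q) • b) = 0)
    (h1 : ∀ f, Φ f (Submodule.Quotient.mk 1) = 0) :
    ∃ Ψ : Module.Dual k (QuadraticDual 𝒜 ⧸ leftIdealOf 𝒜 x E),
      ∀ f b, Ψ (QuadraticDual.ι 𝒜 f • b) = Φ f b := by
  obtain ⟨Θ, hΘ1, hΘ⟩ := exists_linearMap_of_relations x E (extensionAct _ Φ)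
    (fun w hw u => by
      simp only [extensionAct_apply]
      refine Prod.ext ?_ ?_
      · simpa [Prod.fst_sum] using sum_dualRelations_smul_eq_zero x hw u.1
      · simpa [Prod.snd_sum] using hΦ u.1 w hw)
    (Submodule.Quotient.mk 1, 0) (fun s hs => by
      rw [extensionAct_apply, h1, ← Submodule.Quotient.mk_smul, smul_eq_mul, mul_one]
      refine Prod.ext ?_ rfl
      exact (Submodule.Quotient.mk_eq_zero _).mpr (Submodule.subset_span ⟨s, hs, rfl⟩))
  -- `Θ` is only known to commute with $V^*$. Induction over the tensor algebra makes its first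
  -- coordinate $A^!$-linear; it fixes 1, hence is the identity.
  have hfst (b) : (Θ b).1 = b := by
    obtain ⟨a, rfl⟩ := Submodule.Quotient.mk_surjective _ b
    obtain ⟨t, rfl⟩ := RingQuot.mkAlgHom_surjective k (QuadraticDual.Rel 𝒜) a
    have hmk (c : QuadraticDual 𝒜 ⧸ leftIdealOf 𝒜 x E) : (Θ (RingQuot.mkAlgHom k (QuadraticDual.Rel 𝒜) t • c)).1 =
        RingQuot.mkAlgHom k (QuadraticDual.Rel 𝒜) t • (Θ c).1 := by
      induction t using TensorAlgebra.induction generalizing c with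
      | algebraMap r => simp [AlgHom.commutes, algebraMap_smul]
      | ι f =>
        have := hΘ f c
        rw [extensionAct_apply] at this
        exact congrArg Prod.fst this
      | mul s t hs ht => rw [map_mul, mul_smul, mul_smul, hs, ht]
      | add s t hs ht => rw [map_add, add_smul, add_smul, map_add, Prod.fst_add, hs, ht]
    have h := hmk (Submodule.Quotient.mk 1)
    rwa [hΘ1, ← Submodule.Quotient.mk_smul, smul_eq_mul, mul_one] at h
  refine ⟨LinearMap.snd k _ _ ∘ₗ Θ, fun f b => ?_⟩
  rw [LinearMap.comp_apply, hΘ, extensionAct_apply, hfst]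
  rfl

/-! ### Cycles with coefficients in $A_0$ and $A_1$. -/

lemma exists_eq_sum_tmul {n : ℕ} {V W : Type*} [AddCommGroup V] [Module k V] [AddCommGroup W]
    [Module k W] (x : Module.Basis (Fin n) k V) (z : V ⊗[k] W) :
    ∃ φ : Fin n → W, z = ∑ p, x p ⊗ₜ[k] φ p := by
  induction z with
  | zero => exact ⟨0, by simp⟩
  | add a b ha hb =>
    obtain ⟨φ, rfl⟩ := ha
    obtain ⟨ψ, rfl⟩ := hb
    exact ⟨φ + ψ, by simp [TensorProduct.tmul_add, Finset.sum_add_distrib]⟩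
  | tmul v w =>
    refine ⟨fun p => x.repr v p • w, ?_⟩
    conv_lhs => rw [← x.sum_repr v, TensorProduct.sum_tmul]
    simp only [TensorProduct.smul_tmul]

lemma internalComponent_add_le (L : Submodule (QuadraticDual 𝒜) (QuadraticDual 𝒜)) (i j : ℕ) :
    internalComponent 𝒜 L i (i + j) ≤
      LinearMap.range ((𝒜 j).subtype.rTensor (Module.Dual k (quotComponent 𝒜 L i))) := by
  refine iSup₂_le fun a ha => ?_
  obtain rfl : a = j := by omega
  exact le_rfl

/-- The contraction `A ⊗ B*_d → k` with a functional on `A` and an element of `B_d`. -/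
noncomputable def contraction (L : Submodule (QuadraticDual 𝒜) (QuadraticDual 𝒜)) (d : ℕ)
    (f : Module.Dual k A) (b : quotComponent 𝒜 L d) :
    A ⊗[k] Module.Dual k (quotComponent 𝒜 L d) →ₗ[k] k :=
  LinearMap.mul' k k ∘ₗ TensorProduct.map f (Module.Dual.eval k _ b)

@[simp]
lemma contraction_tmul (L : Submodule (QuadraticDual 𝒜) (QuadraticDual 𝒜)) (d : ℕ)
    (f : Module.Dual k A) (b : quotComponent 𝒜 L d) (a : A)
    (φ : Module.Dual k (quotComponent 𝒜 L d)) : contraction L d f b (a ⊗ₜ φ) = f a * φ b := by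
  simp [contraction]

lemma contraction_traceDifferential_tmul {n : ℕ} (x : Module.Basis (Fin n) k (𝒜 1))
    (L : Submodule (QuadraticDual 𝒜) (QuadraticDual 𝒜)) (d : ℕ)
    (f : Module.Dual k A) (b : quotComponent 𝒜 L d) (a : A)
    (φ : Module.Dual k (quotComponent 𝒜 L (d + 1))) :
    contraction L d f b (traceDifferential 𝒜 x L d (a ⊗ₜ φ)) =
      ∑ q, f (a * x q) * φ (leftMul 𝒜 L d (x.coord q) b) := by
  rw [traceDifferential_tmul]
  refine (map_sum (contraction L d f b) _ _).trans ?_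
  exact Finset.sum_congr rfl fun q _ => contraction_tmul L d f b _ _

lemma exists_eq_one_tmul [GradedAlgebra 𝒜] (h𝒜 : IsStandardGraded 𝒜)
    {W : Type*} [AddCommGroup W] [Module k W] (y : 𝒜 0 ⊗[k] W) :
    ∃ φ : W, (𝒜 0).subtype.rTensor W y = 1 ⊗ₜ φ := by
  induction y with
  | zero => exact ⟨0, by simp⟩
  | add a b ha hb =>
    obtain ⟨φ, hφ⟩ := ha
    obtain ⟨ψ, hψ⟩ := hb
    exact ⟨φ + ψ, by rw [map_add, hφ, hψ, TensorProduct.tmul_add]⟩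
  | tmul a φ =>
    obtain ⟨c, hc⟩ := h𝒜.degree_zero a a.2
    refine ⟨c • φ, ?_⟩
    rw [LinearMap.rTensor_tmul, Submodule.subtype_apply, ← hc, Algebra.algebraMap_eq_smul_one,
      TensorProduct.smul_tmul]

/-- There are no nonzero cycles in `A₀ ⊗ B*_{d+1}`. -/
lemma eq_zero_of_mem_internalComponent [GradedAlgebra 𝒜] (h𝒜 : IsStandardGraded 𝒜) {n : ℕ}
    (x : Module.Basis (Fin n) k (𝒜 1)) (L : Submodule (QuadraticDual 𝒜) (QuadraticDual 𝒜)) (d : ℕ)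
    (z : A ⊗[k] Module.Dual k (quotComponent 𝒜 L (d + 1)))
    (hz : z ∈ internalComponent 𝒜 L (d + 1) (d + 1 + 0))
    (hd : traceDifferential 𝒜 x L d z = 0) : z = 0 := by
  obtain ⟨φ, rfl⟩ : ∃ φ, z = 1 ⊗ₜ φ := by
    obtain ⟨y, rfl⟩ := internalComponent_add_le L (d + 1) 0 hz
    exact exists_eq_one_tmul h𝒜 y
  suffices φ = 0 by rw [this, TensorProduct.tmul_zero]
  have hφ (q) (b : quotComponent 𝒜 L d) : φ (leftMul 𝒜 L d (x.coord q) b) = 0 := by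
    -- Contracting with an extension of $x_q^*$ to all of $A$ isolates the coefficient of $x_q$.
    obtain ⟨f, hf⟩ := LinearMap.exists_extend (x.coord q)
    have h := contraction_traceDifferential_tmul x L d f b 1 φ
    have hf' (p) : f (x p) = x.coord q (x p) := LinearMap.congr_fun hf (x p)
    simp only [hd, map_zero, one_mul, hf', x.coord_apply, x.repr_self, Finsupp.single_apply,
      ite_mul, zero_mul, Finset.sum_ite_eq', Finset.mem_univ, if_true] at h
    exact h.symm
  refine LinearMap.ext fun b => ?_
  -- `φ` is defined on $B_{d+1}$ only, so the predicate on $B$ has to carry the membership proof.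
  suffices ∃ hb, φ ⟨(b : QuadraticDual 𝒜 ⧸ L), hb⟩ = 0 from this.2
  refine quotComponent_induction
    (P := fun b => ∃ hb : b ∈ quotComponent 𝒜 L (d + 1), φ ⟨b, hb⟩ = 0) ?_ ?_ b.2
  · intro f b hb
    refine ⟨ι_smul_mem_quotComponent 𝒜 L d f hb, ?_⟩
    have : (⟨QuadraticDual.ι 𝒜 f • b, ι_smul_mem_quotComponent 𝒜 L d f hb⟩ :
        quotComponent 𝒜 L (d + 1)) = ∑ p, f (x p) • leftMul 𝒜 L d (x.coord p) ⟨b, hb⟩ := by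
      refine Subtype.ext ?_
      conv_lhs => rw [← x.sum_dual_apply_smul_coord f]
      simp only [map_sum, map_smul, Finset.sum_smul, smul_assoc, AddSubmonoidClass.coe_finsetSum,
        Submodule.coe_smul]
      rfl
    rw [this]
    simp [hφ]
  · rintro b c ⟨hb, hb'⟩ ⟨hc, hc'⟩
    refine ⟨add_mem hb hc, ?_⟩
    have h : (⟨b + c, add_mem hb hc⟩ : quotComponent 𝒜 L (d + 1)) = ⟨b, hb⟩ + ⟨c, hc⟩ := rfl
    rw [h, map_add, hb', hc', add_zero]

/-- The coefficients of a cycle in `A₁ ⊗ B*_{d+1}` are compatible with the quadratic relations. -/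
lemma sum_dualDistrib_mul_eq_zero {n : ℕ} (x : Module.Basis (Fin n) k (𝒜 1))
    (L : Submodule (QuadraticDual 𝒜) (QuadraticDual 𝒜)) (d : ℕ)
    (φ : Fin n → Module.Dual k (quotComponent 𝒜 L (d + 1)))
    (hφ : traceDifferential 𝒜 x L d (∑ p, (x p : A) ⊗ₜ[k] φ p) = 0) (b : quotComponent 𝒜 L d)
    (w : Module.Dual k (𝒜 1) ⊗[k] Module.Dual k (𝒜 1)) (hw : w ∈ dualRelations 𝒜) :
    ∑ p, ∑ q, TensorProduct.dualDistrib k (𝒜 1) (𝒜 1) w (x p ⊗ₜ x q) *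
      φ p (leftMul 𝒜 L d (x.coord q) b) = 0 := by
  -- The functional of `w` kills the kernel $Q_2$ of the multiplication, so it is
  -- $f\circ\mathrm{mult}$ for some functional $f$ on $A$; contracting the cycle equation with $f$
  -- gives the claim.
  obtain ⟨f, hf⟩ : TensorProduct.dualDistrib k (𝒜 1) (𝒜 1) w ∈
      LinearMap.range (mulDegreeOne 𝒜).dualMap := by
    have h := LinearMap.range_dualMap_eq_dualAnnihilator_ker
      (V₁ := 𝒜 1 ⊗[k] 𝒜 1) (V₂ := A) (mulDegreeOne 𝒜)
    exact h.ge ((Submodule.mem_dualAnnihilator _).mpr hw)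
  have hfx (p q) : TensorProduct.dualDistrib k (𝒜 1) (𝒜 1) w (x p ⊗ₜ x q) = f (x p * x q) := by
    rw [← hf]
    simp [mulDegreeOne]
  have h : contraction L d f b (traceDifferential 𝒜 x L d (∑ p, (x p : A) ⊗ₜ φ p)) =
      ∑ p, ∑ q, f (x p * x q) * φ p (leftMul 𝒜 L d (x.coord q) b) := by
    rw [map_sum]
    refine (map_sum (contraction L d f b) _ _).trans ?_
    exact Finset.sum_congr rfl fun p _ => contraction_traceDifferential_tmul x L d f b _ _
  rw [hφ, map_zero] at h
  simp only [hfx]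
  exact h.symm

/-- The graded form of `exists_functional`: composing with the projection onto $B_{d+1}$ turns each
`φ p` into a functional on all of $B$, and the resulting `Ψ` is restricted to $B_{d+2}$. -/
lemma exists_functional_of_component {n : ℕ} (x : Module.Basis (Fin n) k (𝒜 1)) (E : Set (Fin n))
    (d : ℕ) (φ : Fin n → Module.Dual k (quotComponent 𝒜 (leftIdealOf 𝒜 x E) (d + 1)))
    (hφ : ∀ b, ∀ w ∈ dualRelations 𝒜, ∑ p, ∑ q,
      TensorProduct.dualDistrib k (𝒜 1) (𝒜 1) w (x p ⊗ₜ x q) *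
        φ p (leftMul 𝒜 _ d (x.coord q) b) = 0) :
    ∃ ψ : Module.Dual k (quotComponent 𝒜 (leftIdealOf 𝒜 x E) (d + 1 + 1)),
      ∀ p, dualAct 𝒜 _ (d + 1) (x.coord p) ψ = φ p := by
  obtain ⟨π, hπ, hπ1, hπd⟩ := exists_quotComponent_proj x E
  let φ' (p : Fin n) : Module.Dual k (QuadraticDual 𝒜 ⧸ leftIdealOf 𝒜 x E) :=
    φ p ∘ₗ LinearMap.proj (d + 1) ∘ₗ π
  let Φ : Module.Dual k (𝒜 1) →ₗ[k] Module.Dual k (QuadraticDual 𝒜 ⧸ leftIdealOf 𝒜 x E) :=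
    x.dualBasis.constr k φ'
  have hΦx (p b) : Φ (x.coord p) b = φ p (π b (d + 1)) := by
    rw [← x.coe_dualBasis, x.dualBasis.constr_basis]
    rfl
  -- The class of 1 has degree 0 and projects to zero in degree $d+1$. Positivity of the homological
  -- degree enters here.
  have hΦ1 : (LinearMap.applyₗ (Submodule.Quotient.mk 1)) ∘ₗ Φ = 0 := by
    refine x.dualBasis.ext fun p => ?_
    rw [x.coe_dualBasis]
    exact (hΦx p _).trans (by rw [hπ1, map_zero, LinearMap.zero_apply])
  obtain ⟨Ψ, hΨ⟩ := exists_functional x E Φ (fun b w hw => by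
    simp only [hΦx, hπ]
    exact hφ (π b d) w hw) (LinearMap.congr_fun hΦ1)
  refine ⟨Ψ ∘ₗ (quotComponent 𝒜 _ (d + 1 + 1)).subtype, fun p => LinearMap.ext fun b => ?_⟩
  change Ψ (QuadraticDual.ι 𝒜 (x.coord p) • (b : QuadraticDual 𝒜 ⧸ leftIdealOf 𝒜 x E)) = φ p b
  rw [hΨ, hΦx, hπd]

/-- Cycles in `A₁ ⊗ B*_{d+1}` are boundaries. -/
lemma exists_traceDifferential_eq {n : ℕ}
    (x : Module.Basis (Fin n) k (𝒜 1)) (E : Set (Fin n)) (d : ℕ)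
    (z : A ⊗[k] Module.Dual k (quotComponent 𝒜 (leftIdealOf 𝒜 x E) (d + 1)))
    (hz : z ∈ internalComponent 𝒜 (leftIdealOf 𝒜 x E) (d + 1) (d + 1 + 1))
    (hd : traceDifferential 𝒜 x _ d z = 0) : ∃ y, traceDifferential 𝒜 x _ (d + 1) y = z := by
  obtain ⟨φ, rfl⟩ : ∃ φ : Fin n → _, z = ∑ p, (x p : A) ⊗ₜ[k] φ p := by
    obtain ⟨y, rfl⟩ := internalComponent_add_le _ (d + 1) 1 hz
    obtain ⟨φ, rfl⟩ := exists_eq_sum_tmul x y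
    exact ⟨φ, map_sum ((𝒜 1).subtype.rTensor _) _ _⟩
  obtain ⟨ψ, hψ⟩ := exists_functional_of_component x E d φ
    (sum_dualDistrib_mul_eq_zero x _ d φ hd)
  refine ⟨1 ⊗ₜ ψ, ?_⟩
  rw [traceDifferential_tmul]
  exact Finset.sum_congr rfl fun p _ => congrArg₂ (TensorProduct.tmul k) (one_mul _) (hψ p)

/-! ### From cycles and boundaries to homology. -/

/-- A component of the homology vanishes if the cycles in it are boundaries. -/
lemma homologyComponent_eq_bot {n : ℕ} (x : Module.Basis (Fin n) k (𝒜 1))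
    (L : Submodule (QuadraticDual 𝒜) (QuadraticDual 𝒜)) (d m : ℕ)
    (h : ∀ z ∈ internalComponent 𝒜 L (d + 1) m, traceDifferential 𝒜 x L d z = 0 →
      ∃ y, traceDifferential 𝒜 x L (d + 1) y = z) :
    homologyComponent 𝒜 x L (d + 1) m = ⊥ := by
  have hof (d) : (subPriddyComplex 𝒜 x L).d (d + 1) d =
      ModuleCat.ofHom (traceDifferential 𝒜 x L d) :=
    ChainComplex.of_d (fun d => ModuleCat.of A (A ⊗[k] Module.Dual k (quotComponent 𝒜 L d)))
      (fun d => ModuleCat.ofHom (traceDifferential 𝒜 x L d)) d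
  rw [eq_bot_iff]
  rintro _ ⟨c, hc, rfl⟩
  obtain ⟨y, hy⟩ := h _ hc (by
    have h0 := ConcreteCategory.congr_hom ((subPriddyComplex 𝒜 x L).iCycles_d (d + 1) d) c
    rw [hof] at h0
    exact h0)
  have hcy : c = (subPriddyComplex 𝒜 x L).toCycles (d + 1 + 1) (d + 1) y := by
    -- Cycles embed in the chain module, so the equality can be tested in $A\otimes B_{d+1}^*$.
    apply (ModuleCat.mono_iff_injective ((subPriddyComplex 𝒜 x L).iCycles (d + 1))).mp
      inferInstance
    have h1 := ConcreteCategory.congr_hom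
      ((subPriddyComplex 𝒜 x L).toCycles_i (d + 1 + 1) (d + 1)) y
    rw [hof] at h1
    exact hy.symm.trans h1.symm
  rw [hcy]
  exact ConcreteCategory.congr_hom
    ((subPriddyComplex 𝒜 x L).toCycles_comp_homologyπ (d + 1 + 1) (d + 1)) y

end LinearStrand

theorem mainTheorem5 {k : Type u} [Field k] {A : Type v} [CommRing A] [Algebra k A]
    (𝒜 : ℕ → Submodule k A) [GradedAlgebra 𝒜] (hA : IsKoszul 𝒜)
    {r : ℕ} (ℓ : Fin r → 𝒜 1) (hℓ : MinimallyGenerates (fun j => (ℓ j : A)))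
    {n : ℕ} (x : Module.Basis (Fin n) k (𝒜 1)) (e : Fin r → Fin n) (he : ∀ j, x (e j) = ℓ j)
    (i : ℕ) (hi : 0 < i) (j : ℕ) (hj : j = 0 ∨ j = 1) :
    homologyComponent 𝒜 x (leftIdealOf 𝒜 x (Set.range e)) i (i + j) = ⊥ := by
  obtain ⟨d, rfl⟩ := Nat.exists_eq_add_one_of_ne_zero hi.ne'
  refine homologyComponent_eq_bot x _ d _ fun z hz hd => ?_
  rcases hj with rfl | rfl
  · exact ⟨0, by rw [map_zero, eq_zero_of_mem_internalComponent hA.standard x _ d z hz hd]⟩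
  · exact exists_traceDifferential_eq x _ d z hz hd
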